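/- **Theorem.** Let $1<\beta\le 2$, $\alpha\ge 0$, $\eta>0$. *Notation.* For $u\in L^1(\mathbb R)$ let $\tilde u(k)=\int_{-\infty}^{\infty}e^{ikx}u(x)\,dx$; for functions of $(x,t)$, $\sim$ denotes this transform in $x$. Let $E_{a,b}(z)=\sum_{n\ge0}z^n/\Gamma(an+b)$. For $\nu>0$ let ${}_0D_t^{-\nu}u(t)=\frac1{\Gamma(\nu)}\int_0^t(t-s)^{\nu-1}u(s)\,ds$, and for $\mu\ge0$ let ${}_0D_t^{\mu}u=\frac{d^n}{dt^n}\,{}_0D_t^{-(n-\mu)}u$ with $n=\lfloor\mu\rfloor+1$ (Riemann–Liouville). The space derivative $D_x^\alpha={}_{-\infty}D_x^\alpha$ is understood as the operator with Fourier symbol $-|k|^\alpha$: for $u\in L^1(\mathbb R)$, $w=D_x^\alpha u$ means that $w\in L^1(\mathbb R)$ and $\tilde w(k)=-|k|^\alpha\tilde u(k)$ for all $k$ (with $|0|^0=1$). *Problem.* Let $f,g\in L^1(\mathbb R)$, and let $\varphi(x,t)$ be integrable on $\mathbb R\times(0,T)$ for every $T>0$; all functions are complex-valued, and $\varphi$ may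 be given through $N$. Let $N(x,t)$ be a solution of $${}_0D_t^\beta N(x,t)=\eta\,D_x^\alpha N(x,t)+\varphi(x,t),\qquad x\in\mathbb R,\ t>0,$$ $${}_0D_t^{\beta-1}N(x,0)=f(x),\qquad {}_0D_t^{\beta-2}N(x,0)=g(x),\qquad \lim_{x\to\pm\infty}N(x,t)=0\ \ (t>0),$$ in the following sense. $N$ and ${}_0D_t^\beta N$ are integrable on $\mathbb R\times(0,T)$ for every $T>0$; for every $t>0$ the function $N(\cdot,t)$ is continuous and integrable, and $t\mapsto N(\cdot,t)\in L^1(\mathbb R)$ is continuous on $(0,\infty)$; for almost every $x$, all the derivatives in the definition of ${}_0D_t^\beta N(x,t)$ exist at every $t>0$ and the initial values are attained as limits for $t\to0+$; for every $t>0$, $D_x^\alpha N(\cdot,t)$ exists and the equation holds for almost every $x$. *Conclusion.* Let $t>0$. Then for every $k\in\mathbb R$ $$\tilde N(k,t)=\tilde f(k)\,t^{\beta-1}E_{\beta,\beta}(-\eta|k|^\alpha t^\beta)+\tilde g(k)\,t^{\beta-2}E_{\beta,\beta-1}(-\eta|k|^\alpha t^\beta)+\int_0^t\tilde\varphi(k,t-\xi)\,\xi^{\beta-1}E_{\beta,\beta}(-\eta|k|^\alpha\xi^\beta)\,d\xi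 .$$ Moreover, if the integrals in the following formula converge absolutely (the first two over $k\in\mathbb R$, the last one over $(\xi,k)\in(0,t)\times\mathbb R$), then for every $x\in\mathbb R$ $$\begin{aligned}N(x,t)={}&\frac{t^{\beta-1}}{2\pi}\int_{-\infty}^\infty\tilde f(k)E_{\beta,\beta}(-\eta|k|^\alpha t^\beta)e^{-ikx}\,dk+\frac{t^{\beta-2}}{2\pi}\int_{-\infty}^\infty\tilde g(k)E_{\beta,\beta-1}(-\eta|k|^\alpha t^\beta)e^{-ikx}\,dk\\&+\frac1{2\pi}\int_0^t\xi^{\beta-1}\int_{-\infty}^\infty\tilde\varphi(k,t-\xi)E_{\beta,\beta}(-\eta|k|^\alpha\xi^\beta)e^{-ikx}\,dk\,d\xi .\end{aligned}$$ -/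

import Mathlib

open MeasureTheory Filter Topology Set

noncomputable section

namespace FracReactionDiffusion

/-- The two-parameter Mittag-Leffler function `E_{a,b}(z) = ∑ zⁿ / Γ(a n + b)`. -/
def mittagLeffler (a b z : ℝ) : ℝ :=
  ∑' n : ℕ, z ^ n / Real.Gamma (a * n + b)

/-- The Fourier transform `∫ e^{ikx} u(x) dx`. -/
def fourierTransform (u : ℝ → ℂ) (k : ℝ) : ℂ :=
  ∫ x : ℝ, Complex.exp (Complex.I * k * x) * u x

/-- The Riemann-Liouville fractional integral of order `ν > 0` with base point `0`. -/
def rlIntegral (ν : ℝ) (u : ℝ → ℂ) (t : ℝ) : ℂ :=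
  (Real.Gamma ν)⁻¹ • ∫ s in (0 : ℝ)..t, (t - s) ^ (ν - 1) • u s

/-- The Riemann-Liouville fractional derivative of real order `μ` with base point `0`:
for `μ ≥ 0` it is the `n`-th derivative, `n = ⌊μ⌋ + 1`, of the fractional integral of order
`n - μ`; for `μ < 0` it is the fractional integral of order `-μ`. -/
def rlDeriv (μ : ℝ) (u : ℝ → ℂ) (t : ℝ) : ℂ :=
  if μ < 0 then rlIntegral (-μ) u t
  else iteratedDeriv (⌊μ⌋₊ + 1) (rlIntegral (⌊μ⌋₊ + 1 - μ) u) t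

/-- For `μ ≥ 0`, the Riemann-Liouville derivative of order `μ` exists at every `t > 0`: all the
classical derivatives which occur in its definition exist. -/
def RLDifferentiable (μ : ℝ) (u : ℝ → ℂ) : Prop :=
  ∀ m ≤ ⌊μ⌋₊, ∀ t : ℝ, 0 < t →
    DifferentiableAt ℝ (iteratedDeriv m (rlIntegral (⌊μ⌋₊ + 1 - μ) u)) t

/-- `w` is the fractional space derivative of order `α` of `u`, the operator with Fourier
symbol `-|k|^α`; it determines `w` up to a null set. -/
structure IsSpaceFracDeriv (α : ℝ) (u w : ℝ → ℂ) : Prop where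
  integrable_left : Integrable u
  integrable_right : Integrable w
  fourier_eq : ∀ k : ℝ, fourierTransform w k = -((|k| ^ α : ℝ) : ℂ) * fourierTransform u k

/-- `F` is integrable on every strip `ℝ × (0, T)`. -/
def IntegrableOnStrips (F : ℝ → ℝ → ℂ) : Prop :=
  ∀ T : ℝ, 0 < T → IntegrableOn (fun p : ℝ × ℝ => F p.1 p.2) (univ ×ˢ Ioo 0 T)

/-- `N(x,t)` solves `₀D_t^β N = η D_x^α N + φ` for `t > 0`, with `₀D_t^{β-1} N = f` and
`₀D_t^{β-2} N = g` at `t = 0+`, and `N → 0` as `x → ±∞`. -/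
structure IsSolution (β α η : ℝ) (φ : ℝ → ℝ → ℂ) (f g : ℝ → ℂ) (N : ℝ → ℝ → ℂ) : Prop where
  integrable : IntegrableOnStrips N
  integrable_rlDeriv : IntegrableOnStrips fun x t => rlDeriv β (N x) t
  /-- each time slice is continuous and integrable, and depends on `t` continuously in `L¹` -/
  continuous_slice : ∀ t : ℝ, 0 < t → Continuous fun x => N x t
  integrable_slice : ∀ t : ℝ, 0 < t → Integrable fun x => N x t
  tendsto_slice : ∀ t : ℝ, 0 < t →
    Tendsto (fun s => ∫ x : ℝ, ‖N x s - N x t‖) (𝓝 t) (𝓝 0)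
  /-- the time derivative exists -/
  rlDifferentiable : ∀ᵐ x : ℝ, RLDifferentiable β (N x)
  /-- the evolution equation -/
  equation : ∃ W : ℝ → ℝ → ℂ,
    (∀ t : ℝ, 0 < t → IsSpaceFracDeriv α (fun x => N x t) (fun x => W x t)) ∧
    ∀ t : ℝ, 0 < t → ∀ᵐ x : ℝ, rlDeriv β (N x) t = (η : ℂ) * W x t + φ x t
  /-- the initial conditions -/
  initial_f : ∀ᵐ x : ℝ, Tendsto (fun t => rlDeriv (β - 1) (N x) t) (𝓝[>] 0) (𝓝 (f x))
  initial_g : ∀ᵐ x : ℝ, Tendsto (fun t => rlDeriv (β - 2) (N x) t) (𝓝[>] 0) (𝓝 (g x))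
  /-- the conditions at infinity -/
  tendsto_atTop : ∀ t : ℝ, 0 < t → Tendsto (fun x => N x t) atTop (𝓝 0)
  tendsto_atBot : ∀ t : ℝ, 0 < t → Tendsto (fun x => N x t) atBot (𝓝 0)

end FracReactionDiffusion

end

/-! Write J^ν for `rlIntegral ν`, that is, convolution in time with `rlKernel ν`. By Euler's beta
integral these kernels form a convolution semigroup. For almost every x the initial value problem in
t is integrated from t = 0+ and then hit with J^β, which gives J²N = k_{β+1} g + k_{β+2} f + J^{β+2}
D^β N, where k_ν = `rlKernel ν` (`rlIntegral_two_eq_of_initial`). In this form no regularity of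
N(x,·) beyond integrability and the existence of the derivatives is needed, and all kernels are
bounded on bounded intervals, so Fubini lets the Fourier transform in x pass through. The equation
turns the transform of D^β N into -l Ñ + φ̃ with l = η|k|^α. Since Ñ(k,·) is continuous for t > 0,
the two extra integrations can be differentiated away (`volterra_of_rlIntegral_two`). This leaves n
= k_{β-1} G + k_β F + J^β(-l n + φ̃), with F, G the transforms of f, g. Its Neumann series is a
Mittag-Leffler series (`hasSum_rlKernel`), and the remainder tends to 0 (`volterra_solution`). The
formula for N itself is Fourier inversion: absolute convergence makes Ñ(·,t) integrable, and N(·,t)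
is continuous. -/

noncomputable section

namespace FracReactionDiffusion

/-! ### Riemann-Liouville kernels -/

/-- The convolution kernel `t^(ν-1) / Γ(ν)` of the Riemann-Liouville integral of order `ν`. -/
def rlKernel (ν t : ℝ) : ℝ := t ^ (ν - 1) / Real.Gamma ν

lemma rlKernel_nonneg {ν t : ℝ} (hν : 0 < ν) (ht : 0 ≤ t) : 0 ≤ rlKernel ν t :=
  div_nonneg (Real.rpow_nonneg ht _) (Real.Gamma_pos_of_pos hν).le

lemma rlKernel_pos {ν t : ℝ} (hν : 0 < ν) (ht : 0 < t) : 0 < rlKernel ν t :=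
  div_pos (Real.rpow_pos_of_pos ht _) (Real.Gamma_pos_of_pos hν)

@[fun_prop]
lemma measurable_rlKernel (ν : ℝ) : Measurable (rlKernel ν) := by
  unfold rlKernel; fun_prop

@[fun_prop]
lemma continuous_rlKernel {ν : ℝ} (hν : 1 ≤ ν) : Continuous (rlKernel ν) := by
  unfold rlKernel
  exact (Real.continuous_rpow_const (by linarith)).div_const _

lemma rlKernel_mono {ν s t : ℝ} (hν : 1 ≤ ν) (hs : 0 ≤ s) (hst : s ≤ t) :
    rlKernel ν s ≤ rlKernel ν t :=
  div_le_div_of_nonneg_right (Real.rpow_le_rpow hs hst (by linarith))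
    (Real.Gamma_pos_of_pos (by linarith)).le

@[simp] lemma rlKernel_one (t : ℝ) : rlKernel 1 t = 1 := by simp [rlKernel]

lemma rlIntegral_eq (ν : ℝ) (u : ℝ → ℂ) (t : ℝ) :
    rlIntegral ν u t = ∫ s in (0 : ℝ)..t, rlKernel ν (t - s) • u s := by
  rw [rlIntegral, ← intervalIntegral.integral_smul]
  congr 1 with s
  rw [smul_smul, rlKernel, div_eq_inv_mul]

lemma rlIntegral_one (u : ℝ → ℂ) (t : ℝ) : rlIntegral 1 u t = ∫ s in (0 : ℝ)..t, u s := by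
  simp [rlIntegral_eq]

/-- Euler's beta integral B(b,a) = Γ(b)Γ(a)/Γ(a+b), rescaled to (0,t) and brought from complex to
real powers. -/
lemma integral_rlKernel_mul_zero {a b t : ℝ} (ha : 0 < a) (hb : 0 < b) (ht : 0 < t) :
    ∫ s in (0 : ℝ)..t, rlKernel a (t - s) * rlKernel b s = rlKernel (a + b) t := by
  have hbeta := Complex.betaIntegral_scaled (b : ℂ) (a : ℂ) ht
  rw [Complex.betaIntegral_eq_Gamma_mul_div _ _ (by simpa) (by simpa)] at hbeta
  have h1 : ∫ x in (0 : ℝ)..t, (x : ℂ) ^ ((b : ℂ) - 1) * ((t : ℂ) - x) ^ ((a : ℂ) - 1) =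
      ((∫ x in (0 : ℝ)..t, x ^ (b - 1) * (t - x) ^ (a - 1) : ℝ) : ℂ) := by
    rw [← intervalIntegral.integral_ofReal]
    refine intervalIntegral.integral_congr fun x hx => ?_
    rw [uIcc_of_le ht.le] at hx
    push_cast [Complex.ofReal_cpow hx.1, Complex.ofReal_cpow (sub_nonneg.2 hx.2)]
    rfl
  have h2 : ∫ x in (0 : ℝ)..t, x ^ (b - 1) * (t - x) ^ (a - 1) =
      t ^ (b + a - 1) * (Real.Gamma b * Real.Gamma a / Real.Gamma (b + a)) := by
    rw [h1, ← Complex.ofReal_add, Complex.Gamma_ofReal, Complex.Gamma_ofReal,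
      Complex.Gamma_ofReal] at hbeta
    apply Complex.ofReal_injective
    rw [hbeta]
    push_cast [Complex.ofReal_cpow ht.le]
    rfl
  have h3 : ∀ s, rlKernel a (t - s) * rlKernel b s =
      (Real.Gamma a * Real.Gamma b)⁻¹ * (s ^ (b - 1) * (t - s) ^ (a - 1)) := fun s => by
    rw [rlKernel, rlKernel]; field_simp
  simp_rw [h3]
  rw [intervalIntegral.integral_const_mul, h2, rlKernel, add_comm b a]
  have := Real.Gamma_pos_of_pos ha
  have := Real.Gamma_pos_of_pos hb
  field_simp

/-- The kernels form a convolution semigroup. -/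
lemma integral_rlKernel_mul {a b r t : ℝ} (ha : 0 < a) (hb : 0 < b) (hrt : r < t) :
    ∫ s in r..t, rlKernel a (t - s) * rlKernel b (s - r) = rlKernel (a + b) (t - r) := by
  rw [← integral_rlKernel_mul_zero ha hb (sub_pos.2 hrt)]
  have := intervalIntegral.integral_comp_sub_right (a := r) (b := t)
    (fun s => rlKernel a (t - r - s) * rlKernel b s) r
  simpa using this

lemma intervalIntegrable_rlKernel_mul {a b r t : ℝ} (ha : 0 < a) (hb : 0 < b) (hrt : r < t) :
    IntervalIntegrable (fun s => rlKernel a (t - s) * rlKernel b (s - r)) volume r t := by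
  -- The integral of a non-integrable function is 0 by convention, so a nonzero value certifies
  -- integrability.
  apply intervalIntegral.intervalIntegrable_of_integral_ne_zero
  rw [integral_rlKernel_mul ha hb hrt]
  exact (rlKernel_pos (add_pos ha hb) (sub_pos.2 hrt)).ne'

lemma intervalIntegrable_rlKernel {b t : ℝ} (hb : 0 < b) (ht : 0 < t) :
    IntervalIntegrable (rlKernel b) volume 0 t := by
  simpa using intervalIntegrable_rlKernel_mul one_pos hb ht

lemma intervalIntegrable_rlKernel_smul {ν t : ℝ} (hν : 1 ≤ ν) {u : ℝ → ℂ}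
    (hu : IntervalIntegrable u volume 0 t) :
    IntervalIntegrable (fun s => rlKernel ν (t - s) • u s) volume 0 t :=
  hu.continuousOn_smul
    ((continuous_rlKernel hν).comp (continuous_const.sub continuous_id)).continuousOn

/-! ### Semigroup property of fractional integration -/

section Fubini

variable {a b t : ℝ} {u : ℝ → ℂ}

/-- The integrand of the iterated Riemann-Liouville integral on the triangle `r < s`. -/
def triangleKernel (a b t : ℝ) (u : ℝ → ℂ) (p : ℝ × ℝ) : ℂ :=
  {q : ℝ × ℝ | q.2 < q.1}.indicator
    (fun q => (rlKernel a (t - q.1) * rlKernel b (q.1 - q.2)) • u q.2) p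

lemma triangleKernel_left (s : ℝ) : (fun r => triangleKernel a b t u (s, r)) =
    (Iio s).indicator fun r => (rlKernel a (t - s) * rlKernel b (s - r)) • u r := by
  ext r; simp [triangleKernel, indicator]

lemma triangleKernel_right (r : ℝ) : (fun s => triangleKernel a b t u (s, r)) =
    (Ioi r).indicator fun s => (rlKernel a (t - s) * rlKernel b (s - r)) • u r := by
  ext r; simp [triangleKernel, indicator]

lemma integral_triangleKernel_left {s : ℝ} (hs : s ∈ Ioc 0 t) :
    ∫ r in Ioc 0 t, triangleKernel a b t u (s, r) = rlKernel a (t - s) • rlIntegral b u s := by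
  rw [triangleKernel_left, integral_indicator measurableSet_Iio, Measure.restrict_restrict
    measurableSet_Iio, rlIntegral_eq, intervalIntegral.integral_of_le hs.1.le,
    integral_Ioc_eq_integral_Ioo, ← integral_smul]
  have : Iio s ∩ Ioc 0 t = Ioo 0 s := by
    ext r; simp only [mem_inter_iff, mem_Iio, mem_Ioc, mem_Ioo]
    exact ⟨fun h => ⟨h.2.1, h.1⟩, fun h => ⟨h.2, h.1, (h.2.trans_le hs.2).le⟩⟩
  rw [this]
  simp_rw [smul_smul]

lemma Ioi_inter_Ioc_of_mem {r : ℝ} (hr : r ∈ Ioo 0 t) : Ioi r ∩ Ioc 0 t = Ioc r t := by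
  ext s; simp only [mem_inter_iff, mem_Ioi, mem_Ioc]
  exact ⟨fun h => ⟨h.1, h.2.2⟩, fun h => ⟨h.1, hr.1.trans h.1, h.2⟩⟩

lemma integral_triangleKernel_right (ha : 0 < a) (hb : 0 < b) {r : ℝ} (hr : r ∈ Ioo 0 t) :
    ∫ s in Ioc 0 t, triangleKernel a b t u (s, r) = rlKernel (a + b) (t - r) • u r := by
  rw [triangleKernel_right, integral_indicator measurableSet_Ioi, Measure.restrict_restrict
    measurableSet_Ioi, Ioi_inter_Ioc_of_mem hr, integral_smul_const,
    ← intervalIntegral.integral_of_le hr.2.le, integral_rlKernel_mul ha hb hr.2]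

lemma integral_norm_triangleKernel_right (ha : 0 < a) (hb : 0 < b) {r : ℝ} (hr : r ∈ Ioo 0 t) :
    ∫ s in Ioc 0 t, ‖triangleKernel a b t u (s, r)‖ = ‖rlKernel (a + b) (t - r) • u r‖ := by
  have h : (fun s => ‖triangleKernel a b t u (s, r)‖) = (Ioi r).indicator
      fun s => ‖(rlKernel a (t - s) * rlKernel b (s - r)) • u r‖ := by
    ext s
    rw [← norm_indicator_eq_indicator_norm, ← triangleKernel_right]
  rw [h, integral_indicator measurableSet_Ioi, Measure.restrict_restrict
    measurableSet_Ioi, Ioi_inter_Ioc_of_mem hr, norm_smul, Real.norm_of_nonneg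
    (rlKernel_nonneg (add_pos ha hb) (sub_pos.2 hr.2).le), ← integral_rlKernel_mul ha hb hr.2,
    intervalIntegral.integral_of_le hr.2.le, ← integral_mul_const]
  refine setIntegral_congr_fun measurableSet_Ioc fun s hs => ?_
  rw [norm_smul, Real.norm_of_nonneg (mul_nonneg (rlKernel_nonneg ha (sub_nonneg.2 hs.2))
    (rlKernel_nonneg hb (sub_pos.2 hs.1).le))]

lemma ae_mem_Ioo_restrict_Ioc (t : ℝ) : ∀ᵐ r ∂volume.restrict (Ioc 0 t), r ∈ Ioo 0 t := by
  rw [← Measure.restrict_congr_set Ioo_ae_eq_Ioc]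
  exact ae_restrict_mem measurableSet_Ioo

/-- Integrating the norm over s first gives exactly ‖k_{a+b}(t-r) u(r)‖ by the beta integral. This
is integrable in r because a kernel of order at least 1 is continuous; a and b separately may be
singular. -/
lemma integrable_triangleKernel (ha : 0 < a) (hb : 0 < b) (hab : 1 ≤ a + b) (ht : 0 < t)
    (hu : IntervalIntegrable u volume 0 t) :
    Integrable (triangleKernel a b t u)
      ((volume.restrict (Ioc 0 t)).prod (volume.restrict (Ioc 0 t))) := by
  have hk := intervalIntegrable_rlKernel_smul hab hu
  rw [intervalIntegrable_iff_integrableOn_Ioc_of_le ht.le] at hk hu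
  have hmeas : AEStronglyMeasurable (triangleKernel a b t u)
      ((volume.restrict (Ioc 0 t)).prod (volume.restrict (Ioc 0 t))) := by
    refine AEStronglyMeasurable.indicator ?_ (measurableSet_lt measurable_snd measurable_fst)
    refine AEStronglyMeasurable.smul (f := fun q : ℝ × ℝ => rlKernel a (t - q.1) *
      rlKernel b (q.1 - q.2)) ?_ hu.aestronglyMeasurable.comp_snd
    have : Measurable fun q : ℝ × ℝ => rlKernel a (t - q.1) * rlKernel b (q.1 - q.2) := by
      fun_prop
    exact this.aestronglyMeasurable
  rw [integrable_prod_iff' hmeas]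
  constructor
  · filter_upwards [ae_mem_Ioo_restrict_Ioc t] with r hr
    rw [triangleKernel_right, integrable_indicator_iff measurableSet_Ioi, IntegrableOn,
      Measure.restrict_restrict measurableSet_Ioi, Ioi_inter_Ioc_of_mem hr]
    exact ((intervalIntegrable_iff_integrableOn_Ioc_of_le hr.2.le).1
      (intervalIntegrable_rlKernel_mul ha hb hr.2)).smul_const _
  · refine hk.norm.congr ?_
    filter_upwards [ae_mem_Ioo_restrict_Ioc t] with r hr
    exact (integral_norm_triangleKernel_right ha hb hr).symm

/-- The semigroup property of the Riemann-Liouville integral. -/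
theorem rlIntegral_rlIntegral (ha : 0 < a) (hb : 0 < b) (hab : 1 ≤ a + b) (ht : 0 < t)
    (hu : IntervalIntegrable u volume 0 t) :
    rlIntegral a (rlIntegral b u) t = rlIntegral (a + b) u t := by
  have h := integral_integral_swap (f := fun s r => triangleKernel a b t u (s, r))
    (integrable_triangleKernel ha hb hab ht hu)
  rw [rlIntegral_eq, rlIntegral_eq, intervalIntegral.integral_of_le ht.le,
    intervalIntegral.integral_of_le ht.le]
  calc _ = ∫ s in Ioc 0 t, ∫ r in Ioc 0 t, triangleKernel a b t u (s, r) :=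
        setIntegral_congr_fun measurableSet_Ioc fun s hs => (integral_triangleKernel_left hs).symm
    _ = _ := h
    _ = _ := by
        refine integral_congr_ae ?_
        filter_upwards [ae_mem_Ioo_restrict_Ioc t] with r hr
        exact integral_triangleKernel_right ha hb hr

lemma intervalIntegrable_rlIntegral (hb : 0 < b) (ht : 0 < t)
    (hu : IntervalIntegrable u volume 0 t) :
    IntervalIntegrable (rlIntegral b u) volume 0 t := by
  -- With a = 1 the outer kernel is constantly 1, so the marginal in s is `rlIntegral b u` itself.
  have h := (integrable_triangleKernel one_pos hb (by linarith) ht hu).integral_prod_left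
  rw [intervalIntegrable_iff_integrableOn_Ioc_of_le ht.le]
  refine h.congr ?_
  filter_upwards [ae_restrict_mem measurableSet_Ioc] with s hs
  rw [integral_triangleKernel_left hs, rlKernel_one, one_smul]

end Fubini

/-! ### Calculus of fractional integrals -/

lemma rlIntegral_rlKernel {ν μ t : ℝ} (hν : 0 < ν) (hμ : 0 < μ) (ht : 0 < t) (c : ℂ) :
    rlIntegral ν (fun s => rlKernel μ s • c) t = rlKernel (ν + μ) t • c := by
  rw [rlIntegral_eq, ← integral_rlKernel_mul_zero hν hμ ht, ← intervalIntegral.integral_smul_const]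
  simp_rw [smul_smul]

lemma rlIntegral_congr {ν t : ℝ} {u v : ℝ → ℂ} (ht : 0 < t) (h : ∀ s ∈ Ioo 0 t, u s = v s) :
    rlIntegral ν u t = rlIntegral ν v t := by
  rw [rlIntegral_eq, rlIntegral_eq, intervalIntegral.integral_of_le ht.le,
    intervalIntegral.integral_of_le ht.le, integral_Ioc_eq_integral_Ioo,
    integral_Ioc_eq_integral_Ioo]
  exact setIntegral_congr_fun measurableSet_Ioo fun s hs => congrArg (rlKernel ν (t - s) • ·) (h s hs)

lemma rlIntegral_congr_ae {ν t : ℝ} {u v : ℝ → ℂ} (ht : 0 < t)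
    (h : ∀ᵐ s ∂volume.restrict (Ioo 0 t), u s = v s) :
    rlIntegral ν u t = rlIntegral ν v t := by
  rw [rlIntegral_eq, rlIntegral_eq, intervalIntegral.integral_of_le ht.le,
    intervalIntegral.integral_of_le ht.le, integral_Ioc_eq_integral_Ioo,
    integral_Ioc_eq_integral_Ioo]
  exact integral_congr_ae (h.mono fun s hs => congrArg (rlKernel ν (t - s) • ·) hs)

lemma rlIntegral_add {ν t : ℝ} (hν : 1 ≤ ν) {u v : ℝ → ℂ}
    (hu : IntervalIntegrable u volume 0 t) (hv : IntervalIntegrable v volume 0 t) :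
    rlIntegral ν (fun s => u s + v s) t = rlIntegral ν u t + rlIntegral ν v t := by
  simp_rw [rlIntegral_eq, smul_add]
  exact intervalIntegral.integral_add (intervalIntegrable_rlKernel_smul hν hu)
    (intervalIntegrable_rlKernel_smul hν hv)

lemma rlIntegral_const_mul (ν t : ℝ) (c : ℂ) (u : ℝ → ℂ) :
    rlIntegral ν (fun s => c * u s) t = c * rlIntegral ν u t := by
  rw [rlIntegral_eq, rlIntegral_eq]
  simp_rw [← mul_smul_comm]
  rw [intervalIntegral.integral_const_mul]

lemma norm_rlIntegral_le {ν t : ℝ} (hν : 1 ≤ ν) (ht : 0 < t) {u : ℝ → ℂ}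
    (hu : IntervalIntegrable u volume 0 t) :
    ‖rlIntegral ν u t‖ ≤ rlKernel ν t * ∫ s in (0 : ℝ)..t, ‖u s‖ := by
  rw [rlIntegral_eq, ← intervalIntegral.integral_const_mul]
  refine (intervalIntegral.norm_integral_le_integral_norm ht.le).trans ?_
  refine intervalIntegral.integral_mono_on ht.le (intervalIntegrable_rlKernel_smul hν hu).norm
    (hu.norm.const_mul _) fun s hs => ?_
  rw [norm_smul, Real.norm_of_nonneg (rlKernel_nonneg (by linarith) (sub_nonneg.2 hs.2))]
  gcongr
  exact rlKernel_mono hν (sub_nonneg.2 hs.2) (by linarith [hs.1])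

/-! ### Mittag-Leffler series -/

/-- Ratio test: since a > 1, Γ(y+a) ≥ Γ(y+1) = yΓ(y) for y = an+b large, so consecutive terms have
ratio at most |z|/y. -/
lemma summable_mittagLeffler {a b : ℝ} (ha : 1 < a) (hb : 0 < b) (z : ℝ) :
    Summable fun n : ℕ => z ^ n / Real.Gamma (a * n + b) := by
  have hlin : Tendsto (fun n : ℕ => a * n + b) atTop atTop :=
    tendsto_atTop_add_const_right _ _
      (tendsto_natCast_atTop_atTop.const_mul_atTop (by linarith))
  refine summable_of_ratio_norm_eventually_le (r := 1 / 2) (by norm_num) ?_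
  -- The bound 2 puts the arguments where Γ is increasing; 2|z| makes the ratio at most 1/2.
  filter_upwards [hlin.eventually_ge_atTop (max 2 (2 * |z|))] with n hn
  have h2 := (le_max_left _ _).trans hn
  have hz := (le_max_right _ _).trans hn
  have hG : 0 < Real.Gamma (a * n + b) := Real.Gamma_pos_of_pos (by linarith)
  have hstep : (a * n + b) * Real.Gamma (a * n + b) ≤ Real.Gamma (a * (n + 1 : ℕ) + b) := by
    rw [← Real.Gamma_add_one (by linarith)]
    have h3 : a * n + b + 1 ≤ a * (n + 1 : ℕ) + b := by push_cast; linarith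
    exact Real.Gamma_strictMonoOn_Ici.monotoneOn (mem_Ici.2 (by linarith))
      (mem_Ici.2 (by linarith)) h3
  have hG' : 0 < Real.Gamma (a * (n + 1 : ℕ) + b) := (by positivity : _ < _).trans_le hstep
  rw [norm_div, norm_div, norm_pow, norm_pow, Real.norm_of_nonneg hG.le,
    Real.norm_of_nonneg hG'.le, Real.norm_eq_abs, div_le_iff₀ hG', pow_succ]
  calc |z| ^ n * |z| = 1 / 2 * (|z| ^ n / Real.Gamma (a * n + b)) *
        (2 * |z| * Real.Gamma (a * n + b)) := by field_simp
    _ ≤ 1 / 2 * (|z| ^ n / Real.Gamma (a * n + b)) *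
        ((a * n + b) * Real.Gamma (a * n + b)) := by gcongr
    _ ≤ _ := by gcongr

/-- Iterating J^a on `rlKernel b` gives `rlKernel (a * n + b)`, so this evaluates the Neumann series
of the Volterra equation. -/
lemma hasSum_rlKernel {a b t : ℝ} (ha : 1 < a) (hb : 0 < b) (ht : 0 < t) (z : ℝ) :
    HasSum (fun n : ℕ => z ^ n * rlKernel (a * n + b) t)
      (t ^ (b - 1) * mittagLeffler a b (z * t ^ a)) := by
  have h := (summable_mittagLeffler ha hb (z * t ^ a)).hasSum.mul_left (t ^ (b - 1))
  refine h.congr_fun fun n => ?_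
  rw [rlKernel, mul_pow, ← Real.rpow_mul_natCast ht.le, add_sub_assoc, Real.rpow_add ht]
  ring

/-! ### Primitives and the removal of integrations -/

lemma intervalIntegrable_rlKernel_smul_const {b t : ℝ} (hb : 0 < b) (ht : 0 < t) (c : ℂ) :
    IntervalIntegrable (fun s => rlKernel b s • c) volume 0 t :=
  have h := intervalIntegrable_rlKernel hb ht
  ⟨h.1.smul_const c, h.2.smul_const c⟩

lemma hasDerivAt_integral_of_continuousOn {u : ℝ → ℂ}
    (hu : ∀ T, 0 < T → IntervalIntegrable u volume 0 T) (hc : ContinuousOn u (Ioi 0))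
    {t : ℝ} (ht : 0 < t) : HasDerivAt (fun s => ∫ r in (0 : ℝ)..s, u r) (u t) t :=
  intervalIntegral.integral_hasDerivAt_right (hu t ht)
    (hc.stronglyMeasurableAtFilter isOpen_Ioi t ht) (hc.continuousAt (Ioi_mem_nhds ht))

lemma continuousOn_integral {u : ℝ → ℂ} (hu : ∀ T, 0 < T → IntervalIntegrable u volume 0 T) :
    ContinuousOn (fun s => ∫ r in (0 : ℝ)..s, u r) (Ici 0) := by
  intro t ht
  have ht' : (0 : ℝ) ≤ t := ht
  have h := intervalIntegral.continuousOn_primitive_interval' (hu (t + 1) (by linarith))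
    left_mem_uIcc
  rw [uIcc_of_le (by linarith)] at h
  refine (h t ⟨ht', by linarith⟩).mono_of_mem_nhdsWithin ?_
  rw [← Ici_inter_Iic]
  exact inter_mem_nhdsWithin _ (Iic_mem_nhds (by linarith))

lemma eqOn_of_integral_eqOn {u v : ℝ → ℂ}
    (hu : ∀ T, 0 < T → IntervalIntegrable u volume 0 T) (huc : ContinuousOn u (Ioi 0))
    (hv : ∀ T, 0 < T → IntervalIntegrable v volume 0 T) (hvc : ContinuousOn v (Ioi 0))
    (h : ∀ t, 0 < t → ∫ r in (0 : ℝ)..t, u r = ∫ r in (0 : ℝ)..t, v r) {t : ℝ} (ht : 0 < t) :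
    u t = v t := by
  refine (hasDerivAt_integral_of_continuousOn hu huc ht).unique
    ((hasDerivAt_integral_of_continuousOn hv hvc ht).congr_of_eventuallyEq ?_)
  filter_upwards [Ioi_mem_nhds ht] with s hs using h s hs

lemma rlIntegral_one_eq (u : ℝ → ℂ) : rlIntegral 1 u = fun t => ∫ r in (0 : ℝ)..t, u r :=
  funext (rlIntegral_one u)

lemma rlIntegral_two_eq {u : ℝ → ℂ} {t : ℝ} (ht : 0 < t) (hu : IntervalIntegrable u volume 0 t) :
    rlIntegral 2 u t = ∫ s in (0 : ℝ)..t, ∫ r in (0 : ℝ)..s, u r := by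
  rw [← one_add_one_eq_two, ← rlIntegral_rlIntegral one_pos one_pos (by norm_num) ht hu,
    rlIntegral_one, rlIntegral_one_eq]

lemma eqOn_of_rlIntegral_two_eqOn {u v : ℝ → ℂ}
    (hu : ∀ T, 0 < T → IntervalIntegrable u volume 0 T) (huc : ContinuousOn u (Ioi 0))
    (hv : ∀ T, 0 < T → IntervalIntegrable v volume 0 T) (hvc : ContinuousOn v (Ioi 0))
    (h : ∀ t, 0 < t → rlIntegral 2 u t = rlIntegral 2 v t) {t : ℝ} (ht : 0 < t) :
    u t = v t := by
  refine eqOn_of_integral_eqOn hu huc hv hvc (fun t ht => ?_) ht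
  have key : ∀ {w : ℝ → ℂ}, (∀ T, 0 < T → IntervalIntegrable w volume 0 T) → ∀ T, 0 < T →
      IntervalIntegrable (fun s => ∫ r in (0 : ℝ)..s, w r) volume 0 T := fun {w} hw T hT => by
    refine ((continuousOn_integral hw).mono ?_).intervalIntegrable
    rw [uIcc_of_le hT.le]; exact Icc_subset_Ici_self
  refine eqOn_of_integral_eqOn (key hu) ((continuousOn_integral hu).mono Ioi_subset_Ici_self)
    (key hv) ((continuousOn_integral hv).mono Ioi_subset_Ici_self) (fun s hs => ?_) ht
  rw [← rlIntegral_two_eq hs (hu s hs), ← rlIntegral_two_eq hs (hv s hs), h s hs]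

/-- J^ν = J^1 J^{ν-1} is a primitive of an integrable function; ν > 1 keeps the inner order
positive. -/
lemma continuousOn_rlIntegral {ν : ℝ} (hν : 1 < ν) {u : ℝ → ℂ}
    (hu : ∀ T, 0 < T → IntervalIntegrable u volume 0 T) :
    ContinuousOn (rlIntegral ν u) (Ioi 0) := by
  have h := (continuousOn_integral fun T hT =>
    intervalIntegrable_rlIntegral (sub_pos.2 hν) hT (hu T hT)).mono Ioi_subset_Ici_self
  refine h.congr fun t ht => ?_
  beta_reduce
  rw [← rlIntegral_one, rlIntegral_rlIntegral one_pos (sub_pos.2 hν) (by linarith) ht (hu t ht),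
    add_sub_cancel]

lemma continuousOn_rlKernel (ν : ℝ) : ContinuousOn (rlKernel ν) (Ioi 0) := fun t ht =>
  ((Real.continuousAt_rpow_const t _ (Or.inl (ne_of_gt ht))).div_const _).continuousWithinAt

/-! ### Solution of the Volterra equation -/

section Volterra

variable {β l : ℝ} {n φ : ℝ → ℂ} {F G : ℂ}

/-- Two integrations can be removed from the twice integrated Volterra equation. -/
lemma volterra_of_rlIntegral_two (hβ : 1 < β)
    (hn : ∀ T, 0 < T → IntervalIntegrable n volume 0 T) (hnc : ContinuousOn n (Ioi 0))
    {v : ℝ → ℂ} (hv : ∀ T, 0 < T → IntervalIntegrable v volume 0 T)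
    (h : ∀ t, 0 < t → rlIntegral 2 n t = rlKernel (β + 1) t • G + rlKernel (β + 2) t • F +
      rlIntegral (β + 2) v t) {t : ℝ} (ht : 0 < t) :
    n t = rlKernel (β - 1) t • G + rlKernel β t • F + rlIntegral β v t := by
  have i1 : ∀ T, 0 < T → IntervalIntegrable (fun t => rlKernel (β - 1) t • G) volume 0 T :=
    fun T hT => intervalIntegrable_rlKernel_smul_const (sub_pos.2 hβ) hT G
  have i2 : ∀ T, 0 < T → IntervalIntegrable (fun t => rlKernel β t • F) volume 0 T :=
    fun T hT => intervalIntegrable_rlKernel_smul_const (by linarith) hT F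
  have i3 : ∀ T, 0 < T → IntervalIntegrable (rlIntegral β v) volume 0 T :=
    fun T hT => intervalIntegrable_rlIntegral (by linarith) hT (hv T hT)
  refine eqOn_of_rlIntegral_two_eqOn
    (v := fun t => rlKernel (β - 1) t • G + rlKernel β t • F + rlIntegral β v t) hn hnc
    (fun T hT => ((i1 T hT).add (i2 T hT)).add (i3 T hT)) ?_ (fun t ht => ?_) ht
  · exact (((continuousOn_rlKernel _).smul continuousOn_const).add
      ((continuousOn_rlKernel _).smul continuousOn_const)).add (continuousOn_rlIntegral hβ hv)
  · rw [h t ht, rlIntegral_add one_le_two ((i1 t ht).add (i2 t ht)) (i3 t ht),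
      rlIntegral_add one_le_two (i1 t ht) (i2 t ht),
      rlIntegral_rlKernel two_pos (sub_pos.2 hβ) ht,
      rlIntegral_rlKernel two_pos (by linarith) ht,
      rlIntegral_rlIntegral two_pos (by linarith) (by linarith) ht (hv t ht)]
    rw [show 2 + (β - 1) = β + 1 by ring, add_comm 2 β]

/-- J^ν applied to the Volterra equation. With ν = βM + β it rewrites the remainder of the M-th
iterate. -/
lemma rlIntegral_volterra (hβ : 1 < β)
    (hn : ∀ T, 0 < T → IntervalIntegrable n volume 0 T)
    (hφ : ∀ T, 0 < T → IntervalIntegrable φ volume 0 T)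
    (h : ∀ t, 0 < t → n t = rlKernel (β - 1) t • G + rlKernel β t • F +
      rlIntegral β (fun s => -(l : ℂ) * n s + φ s) t)
    {ν t : ℝ} (hν : 1 ≤ ν) (ht : 0 < t) :
    rlIntegral ν n t = rlKernel (ν + β - 1) t • G + rlKernel (ν + β) t • F +
      (-(l : ℂ) * rlIntegral (ν + β) n t + rlIntegral (ν + β) φ t) := by
  have hv : IntervalIntegrable (fun s => -(l : ℂ) * n s + φ s) volume 0 t :=
    ((hn t ht).const_mul _).add (hφ t ht)
  have i1 : IntervalIntegrable (fun t => rlKernel (β - 1) t • G) volume 0 t :=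
    intervalIntegrable_rlKernel_smul_const (sub_pos.2 hβ) ht G
  have i2 : IntervalIntegrable (fun t => rlKernel β t • F) volume 0 t :=
    intervalIntegrable_rlKernel_smul_const (by linarith) ht F
  have i3 := intervalIntegrable_rlIntegral (b := β) (by linarith) ht hv
  rw [rlIntegral_congr ht fun s hs => h s hs.1, rlIntegral_add hν (i1.add i2) i3,
    rlIntegral_add hν i1 i2, rlIntegral_rlKernel (by linarith) (sub_pos.2 hβ) ht,
    rlIntegral_rlKernel (by linarith) (by linarith) ht,
    rlIntegral_rlIntegral (by linarith) (by linarith) (by linarith) ht hv,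
    rlIntegral_add (by linarith) ((hn t ht).const_mul _) (hφ t ht), rlIntegral_const_mul,
    add_sub_assoc]

lemma volterra_iterate (hβ : 1 < β)
    (hn : ∀ T, 0 < T → IntervalIntegrable n volume 0 T)
    (hφ : ∀ T, 0 < T → IntervalIntegrable φ volume 0 T)
    (h : ∀ t, 0 < t → n t = rlKernel (β - 1) t • G + rlKernel β t • F +
      rlIntegral β (fun s => -(l : ℂ) * n s + φ s) t)
    {t : ℝ} (ht : 0 < t) (M : ℕ) :
    n t = (∑ m ∈ Finset.range (M + 1), ((((-l) ^ m * rlKernel (β * m + (β - 1)) t : ℝ) : ℂ) * G +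
        (((-l) ^ m * rlKernel (β * m + β) t : ℝ) : ℂ) * F +
        (-(l : ℂ)) ^ m * rlIntegral (β * m + β) φ t)) +
      (-(l : ℂ)) ^ (M + 1) * rlIntegral (β * M + β) n t := by
  induction M with
  | zero =>
    rw [h t ht, rlIntegral_add hβ.le ((hn t ht).const_mul _) (hφ t ht), rlIntegral_const_mul]
    simp
    ring
  | succ M ih =>
    rw [Finset.sum_range_succ, ih, rlIntegral_volterra hβ hn hφ h (ν := β * M + β)
      (by nlinarith [(Nat.cast_nonneg M : (0 : ℝ) ≤ M)]) ht]
    have e1 : β * M + β + β = β * (M + 1 : ℕ) + β := by push_cast; ring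
    have e2 : β * M + β + β - 1 = β * (M + 1 : ℕ) + (β - 1) := by push_cast; ring
    rw [e2, e1]
    simp only [Complex.real_smul]
    push_cast
    ring

/-- Up to the factor |l| and the L¹ norm of n on (0,t), the remainder is bounded by the M-th term of
a convergent Mittag-Leffler series. -/
lemma tendsto_volterra_remainder (hβ : 1 < β)
    (hn : ∀ T, 0 < T → IntervalIntegrable n volume 0 T)
    {t : ℝ} (ht : 0 < t) :
    Tendsto (fun M : ℕ => (-(l : ℂ)) ^ (M + 1) * rlIntegral (β * M + β) n t) atTop (𝓝 0) := by
  have hs := (hasSum_rlKernel hβ (by linarith : 0 < β) ht |l|).summable.tendsto_atTop_zero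
  have hs' := (hs.const_mul |l|).mul_const (∫ s in (0 : ℝ)..t, ‖n s‖)
  rw [mul_zero, zero_mul] at hs'
  refine squeeze_zero_norm (fun M => ?_) hs'
  rw [norm_mul, norm_pow, norm_neg, Complex.norm_real, Real.norm_eq_abs, pow_succ']
  have := norm_rlIntegral_le (ν := β * M + β)
    (by nlinarith [(Nat.cast_nonneg M : (0 : ℝ) ≤ M)]) ht (hn t ht)
  calc _ ≤ |l| * |l| ^ M * (rlKernel (β * M + β) t * ∫ s in (0 : ℝ)..t, ‖n s‖) := by gcongr
    _ = _ := by ring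

/-- Dominated convergence: kernels of order at least 1 are increasing, so k_{βm+β}(t-s) is at most
k_{βm+β}(t), whose series weighted by |l|^m converges. -/
lemma hasSum_rlIntegral (hβ : 1 < β)
    (hφ : ∀ T, 0 < T → IntervalIntegrable φ volume 0 T)
    {t : ℝ} (ht : 0 < t) :
    HasSum (fun m : ℕ => (-(l : ℂ)) ^ m * rlIntegral (β * m + β) φ t)
      (∫ ξ in (0 : ℝ)..t, φ (t - ξ) *
        ((ξ ^ (β - 1) * mittagLeffler β β (-l * ξ ^ β) : ℝ) : ℂ)) := by
  have hβ0 : 0 < β := by linarith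
  have h1 : ∀ m : ℕ, 1 ≤ β * m + β := fun m => by
    nlinarith [(Nat.cast_nonneg m : (0 : ℝ) ≤ m)]
  have hi := hφ t ht
  have key : HasSum (fun m : ℕ => ∫ s in (0 : ℝ)..t,
      φ s * (((-l) ^ m * rlKernel (β * m + β) (t - s) : ℝ) : ℂ))
      (∫ s in (0 : ℝ)..t, φ s *
        (((t - s) ^ (β - 1) * mittagLeffler β β (-l * (t - s) ^ β) : ℝ) : ℂ)) := by
    refine intervalIntegral.hasSum_integral_of_dominated_convergence
      (fun m s => ‖φ s‖ * (|l| ^ m * rlKernel (β * m + β) t)) (fun m => ?_) (fun m => ?_) ?_ ?_ ?_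
    · refine hi.def'.aestronglyMeasurable.mul ?_
      have : Measurable fun s => (((-l) ^ m * rlKernel (β * m + β) (t - s) : ℝ) : ℂ) := by
        fun_prop
      exact this.aestronglyMeasurable
    · refine Eventually.of_forall fun s hs => ?_
      rw [uIoc_of_le ht.le] at hs
      rw [norm_mul, Complex.norm_real, norm_mul, norm_pow, norm_neg, Real.norm_eq_abs l,
        Real.norm_of_nonneg (rlKernel_nonneg (by linarith [h1 m]) (sub_nonneg.2 hs.2))]
      gcongr
      exact rlKernel_mono (h1 m) (sub_nonneg.2 hs.2) (by linarith [hs.1])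
    · exact Eventually.of_forall fun s _ =>
        (hasSum_rlKernel hβ hβ0 ht |l|).summable.mul_left _
    · simp_rw [tsum_mul_left]
      exact hi.norm.mul_const _
    -- The endpoint s = t is discarded because `hasSum_rlKernel` needs a positive time t - s.
    · have hne : ∀ᵐ s : ℝ, s ≠ t := by simp [ae_iff]
      filter_upwards [hne] with s hst hs
      rw [uIoc_of_le ht.le] at hs
      exact (Complex.hasSum_ofReal.2 (hasSum_rlKernel hβ hβ0
        (sub_pos.2 (lt_of_le_of_ne hs.2 hst)) (-l))).mul_left _
  have hsub := intervalIntegral.integral_comp_sub_left (a := 0) (b := t) (fun s => φ s *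
        (((t - s) ^ (β - 1) * mittagLeffler β β (-l * (t - s) ^ β) : ℝ) : ℂ)) t
  simp only [sub_sub_cancel, sub_self, sub_zero] at hsub
  rw [hsub]
  refine key.congr_fun fun m => ?_
  rw [rlIntegral_eq, ← intervalIntegral.integral_const_mul]
  congr 1 with s
  rw [Complex.real_smul]
  push_cast
  ring

/-- The Mittag-Leffler solution of the Volterra equation. -/
theorem volterra_solution (hβ : 1 < β)
    (hn : ∀ T, 0 < T → IntervalIntegrable n volume 0 T)
    (hφ : ∀ T, 0 < T → IntervalIntegrable φ volume 0 T)
    (h : ∀ t, 0 < t → n t = rlKernel (β - 1) t • G + rlKernel β t • F +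
      rlIntegral β (fun s => -(l : ℂ) * n s + φ s) t)
    {t : ℝ} (ht : 0 < t) :
    n t = F * ((t ^ (β - 1) * mittagLeffler β β (-l * t ^ β) : ℝ) : ℂ) +
      G * ((t ^ (β - 2) * mittagLeffler β (β - 1) (-l * t ^ β) : ℝ) : ℂ) +
      ∫ ξ in (0 : ℝ)..t, φ (t - ξ) *
        ((ξ ^ (β - 1) * mittagLeffler β β (-l * ξ ^ β) : ℝ) : ℂ) := by
  have s1 := (Complex.hasSum_ofReal.2 (hasSum_rlKernel hβ (sub_pos.2 hβ) ht (-l))).mul_right G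
  have s2 := (Complex.hasSum_ofReal.2
    (hasSum_rlKernel hβ (by linarith : 0 < β) ht (-l))).mul_right F
  have s3 := hasSum_rlIntegral (l := l) hβ hφ ht
  -- The shift by 1 matches the range M + 1 in `volterra_iterate`.
  have hs := (((s1.add s2).add s3).tendsto_sum_nat.comp (tendsto_add_atTop_nat 1)).add
    (tendsto_volterra_remainder (l := l) hβ hn ht)
  have hconst : Tendsto (fun _ : ℕ => n t) atTop (𝓝 (n t)) := tendsto_const_nhds
  have := tendsto_nhds_unique (hconst.congr fun M => volterra_iterate hβ hn hφ h ht M) hs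
  rw [this, show β - 1 - 1 = β - 2 by ring]
  ring

end Volterra

/-! ### Riemann-Liouville derivatives and the integrated initial value problem -/

lemma eq_add_rlIntegral_of_hasDerivAt {F F' : ℝ → ℂ} {c : ℂ}
    (hF : ∀ t, 0 < t → HasDerivAt F (F' t) t)
    (hF' : ∀ T, 0 < T → IntervalIntegrable F' volume 0 T)
    (hc : Tendsto F (𝓝[>] 0) (𝓝 c)) {t : ℝ} (ht : 0 < t) :
    F t = c + rlIntegral 1 F' t := by
  rw [rlIntegral_one, intervalIntegral.integral_eq_sub_of_hasDerivAt_of_tendsto ht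
    (fun s hs => hF s hs.1) (hF' t ht) hc
    ((hF t ht).continuousAt.tendsto.mono_left nhdsWithin_le_nhds)]
  ring

lemma floor_eq_one {β : ℝ} (hβ₁ : 1 < β) (hβ₂ : β < 2) : ⌊β⌋₊ = 1 := by
  rw [Nat.floor_eq_iff (by linarith)]
  constructor <;> norm_num <;> linarith

lemma floor_sub_one_eq_zero {β : ℝ} (hβ₂ : β < 2) : ⌊β - 1⌋₊ = 0 := by
  rw [Nat.floor_eq_zero]; linarith

section RLDeriv

variable {β : ℝ} {u : ℝ → ℂ}

lemma rlDeriv_of_one_lt (hβ₁ : 1 < β) (hβ₂ : β < 2) :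
    rlDeriv β u = iteratedDeriv 2 (rlIntegral (2 - β) u) := by
  ext t
  rw [rlDeriv, if_neg (by linarith), floor_eq_one hβ₁ hβ₂]
  norm_num

lemma rlDeriv_sub_one (hβ₁ : 1 < β) (hβ₂ : β < 2) :
    rlDeriv (β - 1) u = iteratedDeriv 1 (rlIntegral (2 - β) u) := by
  ext t
  rw [rlDeriv, if_neg (by linarith), floor_sub_one_eq_zero hβ₂]
  congr 2
  push_cast; ring

lemma rlDeriv_sub_two (hβ₂ : β < 2) : rlDeriv (β - 2) u = rlIntegral (2 - β) u := by
  ext t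
  rw [rlDeriv, if_pos (by linarith), neg_sub]

/-- At integer order the definition takes one derivative more, of the primitive of u. Hence at β = 2
the initial data are derivatives of `rlIntegral 1 u`, and the case needs separate treatment. -/
lemma rlDeriv_natCast (n : ℕ) : rlDeriv n u = iteratedDeriv (n + 1) (rlIntegral 1 u) := by
  ext t
  rw [rlDeriv, if_neg (by simp), Nat.floor_natCast, add_sub_cancel_left]

lemma rlDeriv_two : rlDeriv 2 u = iteratedDeriv 3 (rlIntegral 1 u) := rlDeriv_natCast 2

lemma rlDeriv_two_sub_one : rlDeriv (2 - 1) u = iteratedDeriv 2 (rlIntegral 1 u) := by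
  rw [show (2 : ℝ) - 1 = (1 : ℕ) by norm_num]; exact rlDeriv_natCast 1

lemma rlDeriv_two_sub_two : rlDeriv (2 - 2) u = iteratedDeriv 1 (rlIntegral 1 u) := by
  rw [show (2 : ℝ) - 2 = (0 : ℕ) by norm_num]; exact rlDeriv_natCast 0

lemma hasDerivAt_iteratedDeriv {v : ℝ → ℂ} {m : ℕ} {t : ℝ}
    (h : DifferentiableAt ℝ (iteratedDeriv m v) t) :
    HasDerivAt (iteratedDeriv m v) (iteratedDeriv (m + 1) v t) t := by
  rw [iteratedDeriv_succ]; exact h.hasDerivAt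

lemma RLDifferentiable.hasDerivAt_sub_one (hβ₁ : 1 < β) (hβ₂ : β ≤ 2)
    (h : RLDifferentiable β u) {t : ℝ} (ht : 0 < t) :
    HasDerivAt (rlDeriv (β - 1) u) (rlDeriv β u t) t := by
  obtain hβ | rfl := hβ₂.lt_or_eq
  · have h1 := h 1 (floor_eq_one hβ₁ hβ).ge t ht
    rw [floor_eq_one hβ₁ hβ, Nat.cast_one, one_add_one_eq_two] at h1
    rw [rlDeriv_sub_one hβ₁ hβ, rlDeriv_of_one_lt hβ₁ hβ]
    exact hasDerivAt_iteratedDeriv h1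
  · have h1 := h 2 (by simp) t ht
    norm_num at h1
    rw [rlDeriv_two_sub_one, rlDeriv_two]
    exact hasDerivAt_iteratedDeriv h1

lemma RLDifferentiable.hasDerivAt_sub_two (hβ₁ : 1 < β) (hβ₂ : β ≤ 2)
    (h : RLDifferentiable β u) {t : ℝ} (ht : 0 < t) :
    HasDerivAt (rlDeriv (β - 2) u) (rlDeriv (β - 1) u t) t := by
  obtain hβ | rfl := hβ₂.lt_or_eq
  · have h1 := h 0 (by simp) t ht
    rw [floor_eq_one hβ₁ hβ, Nat.cast_one, one_add_one_eq_two] at h1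
    rw [rlDeriv_sub_one hβ₁ hβ, rlDeriv_sub_two hβ, ← iteratedDeriv_zero (f := rlIntegral _ _)]
    exact hasDerivAt_iteratedDeriv h1
  · have h1 := h 1 (by simp) t ht
    norm_num at h1
    rw [← iteratedDeriv_one] at h1
    rw [rlDeriv_two_sub_one, rlDeriv_two_sub_two]
    exact hasDerivAt_iteratedDeriv h1

lemma tendsto_rlIntegral_one (hu : ∀ T, 0 < T → IntervalIntegrable u volume 0 T) :
    Tendsto (rlIntegral 1 u) (𝓝[>] 0) (𝓝 0) := by
  have h := (continuousOn_integral hu 0 self_mem_Ici).tendsto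
  rw [intervalIntegral.integral_same] at h
  rw [rlIntegral_one_eq]
  exact h.mono_left (nhdsWithin_mono _ Ioi_subset_Ici_self)

/-- Integrating `₀D_t^{β-2} u` of order `β` gives the second primitive of `u`. -/
lemma rlIntegral_rlDeriv_sub_two (hβ₁ : 1 < β) (hβ₂ : β ≤ 2)
    (hu : ∀ T, 0 < T → IntervalIntegrable u volume 0 T)
    (hJ : ∀ T, 0 < T → IntervalIntegrable (rlDeriv (β - 2) u) volume 0 T)
    (h : RLDifferentiable β u) {t : ℝ} (ht : 0 < t) :
    rlIntegral β (rlDeriv (β - 2) u) t = rlIntegral 2 u t := by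
  obtain hβ | rfl := hβ₂.lt_or_eq
  · rw [rlDeriv_sub_two hβ, rlIntegral_rlIntegral (by linarith) (by linarith) (by linarith) ht
      (hu t ht), add_sub_cancel]
  -- For β = 2 the order-0 derivative is the derivative of the primitive of u and need not equal u
  -- pointwise. Only their primitives are compared: both vanish at 0+.
  · have hF : ∀ t, 0 < t → HasDerivAt (rlIntegral 1 u) (rlDeriv (2 - 2) u t) t := by
      intro t ht
      have h1 := h 0 (by simp) t ht
      norm_num at h1
      rw [rlDeriv_two_sub_two, iteratedDeriv_one]
      exact h1.hasDerivAt
    have hadd : (2 : ℝ) = 1 + 1 := by norm_num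
    have key : ∀ v : ℝ → ℂ, IntervalIntegrable v volume 0 t →
        rlIntegral 2 v t = rlIntegral 1 (rlIntegral 1 v) t := fun v hv => by
      rw [rlIntegral_rlIntegral one_pos one_pos (by norm_num) ht hv, hadd]
    rw [key _ (hJ t ht), key u (hu t ht)]
    refine rlIntegral_congr ht fun s hs => ?_
    rw [eq_add_rlIntegral_of_hasDerivAt hF hJ (tendsto_rlIntegral_one hu) hs.1, zero_add]

/-- The initial value problem for `₀D_t^β u` in integrated form. -/
theorem rlIntegral_two_eq_of_initial (hβ₁ : 1 < β) (hβ₂ : β ≤ 2) {f g : ℂ}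
    (hu : ∀ T, 0 < T → IntervalIntegrable u volume 0 T)
    (hD : ∀ T, 0 < T → IntervalIntegrable (rlDeriv β u) volume 0 T)
    (h : RLDifferentiable β u)
    (hf : Tendsto (rlDeriv (β - 1) u) (𝓝[>] 0) (𝓝 f))
    (hg : Tendsto (rlDeriv (β - 2) u) (𝓝[>] 0) (𝓝 g)) {t : ℝ} (ht : 0 < t) :
    rlIntegral 2 u t = rlKernel (β + 1) t • g + rlKernel (β + 2) t • f +
      rlIntegral (β + 2) (rlDeriv β u) t := by
  have hβ0 : 0 < β := by linarith
  have h1 : ∀ t, 0 < t → rlDeriv (β - 1) u t = rlKernel 1 t • f +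
      rlIntegral 1 (rlDeriv β u) t := fun t ht => by
    rw [rlKernel_one, one_smul]
    exact eq_add_rlIntegral_of_hasDerivAt (fun t ht => h.hasDerivAt_sub_one hβ₁ hβ₂ ht) hD hf ht
  have hcongr : ∀ {v w : ℝ → ℂ} {T : ℝ}, 0 < T → (∀ s, 0 < s → v s = w s) →
      IntervalIntegrable w volume 0 T → IntervalIntegrable v volume 0 T := fun hT hvw hw =>
    hw.congr fun s hs => by
      rw [uIoc_of_le hT.le] at hs; exact (hvw s hs.1).symm
  have i1 : ∀ T, 0 < T → IntervalIntegrable (fun t => rlKernel 1 t • f) volume 0 T := fun T hT =>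
    intervalIntegrable_rlKernel_smul_const one_pos hT f
  have i2 : ∀ T, 0 < T → IntervalIntegrable (rlIntegral 1 (rlDeriv β u)) volume 0 T :=
    fun T hT => intervalIntegrable_rlIntegral one_pos hT (hD T hT)
  have hJ1 : ∀ T, 0 < T → IntervalIntegrable (rlDeriv (β - 1) u) volume 0 T := fun T hT =>
    hcongr hT h1 ((i1 T hT).add (i2 T hT))
  have h2 : ∀ t, 0 < t → rlDeriv (β - 2) u t = rlKernel 1 t • g + rlKernel 2 t • f +
      rlIntegral 2 (rlDeriv β u) t := fun t ht => by
    rw [eq_add_rlIntegral_of_hasDerivAt (fun t ht => h.hasDerivAt_sub_two hβ₁ hβ₂ ht) hJ1 hg ht,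
      rlIntegral_congr ht fun s hs => h1 s hs.1, rlIntegral_add le_rfl (i1 t ht) (i2 t ht),
      rlIntegral_rlKernel one_pos one_pos ht,
      rlIntegral_rlIntegral one_pos one_pos (by norm_num) ht (hD t ht), one_add_one_eq_two,
      rlKernel_one, one_smul, add_assoc]
  have i3 : ∀ T, 0 < T → IntervalIntegrable (fun t => rlKernel 1 t • g) volume 0 T := fun T hT =>
    intervalIntegrable_rlKernel_smul_const one_pos hT g
  have i4 : ∀ T, 0 < T → IntervalIntegrable (fun t => rlKernel 2 t • f) volume 0 T := fun T hT =>
    intervalIntegrable_rlKernel_smul_const two_pos hT f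
  have i5 : ∀ T, 0 < T → IntervalIntegrable (rlIntegral 2 (rlDeriv β u)) volume 0 T :=
    fun T hT => intervalIntegrable_rlIntegral two_pos hT (hD T hT)
  have hJ : ∀ T, 0 < T → IntervalIntegrable (rlDeriv (β - 2) u) volume 0 T := fun T hT =>
    hcongr hT h2 (((i3 T hT).add (i4 T hT)).add (i5 T hT))
  -- Applying J^β to the formula for the derivative of order β - 2 produces J²u on the left.
  rw [← rlIntegral_rlDeriv_sub_two hβ₁ hβ₂ hu hJ h ht, rlIntegral_congr ht fun s hs => h2 s hs.1,
    rlIntegral_add hβ₁.le ((i3 t ht).add (i4 t ht)) (i5 t ht),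
    rlIntegral_add hβ₁.le (i3 t ht) (i4 t ht), rlIntegral_rlKernel hβ0 one_pos ht,
    rlIntegral_rlKernel hβ0 two_pos ht,
    rlIntegral_rlIntegral hβ0 two_pos (by linarith) ht (hD t ht)]

end RLDeriv

/-! ### Fourier transform and inversion -/

section FourierTransform

/-- The character `x ↦ e^{ikx}`. -/
def fourierExp (k x : ℝ) : ℂ := Complex.exp (Complex.I * k * x)

lemma norm_fourierExp (k x : ℝ) : ‖fourierExp k x‖ = 1 := by
  rw [fourierExp, mul_assoc, ← Complex.ofReal_mul, mul_comm, Complex.norm_exp_ofReal_mul_I]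

@[fun_prop]
lemma continuous_fourierExp (k : ℝ) : Continuous (fourierExp k) := by
  unfold fourierExp; fun_prop

lemma fourierTransform_eq (u : ℝ → ℂ) (k : ℝ) :
    fourierTransform u k = ∫ x : ℝ, fourierExp k x * u x := rfl

lemma integrable_fourierExp_mul {u : ℝ → ℂ} (hu : Integrable u) (k : ℝ) :
    Integrable fun x => fourierExp k x * u x :=
  hu.bdd_mul (c := 1) (continuous_fourierExp k).aestronglyMeasurable
    (Eventually.of_forall fun x => (norm_fourierExp k x).le)

lemma fourierTransform_add {u v : ℝ → ℂ} (hu : Integrable u) (hv : Integrable v) (k : ℝ) :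
    fourierTransform (fun x => u x + v x) k = fourierTransform u k + fourierTransform v k := by
  simp_rw [fourierTransform_eq, mul_add]
  exact integral_add (integrable_fourierExp_mul hu k) (integrable_fourierExp_mul hv k)

lemma fourierTransform_sub {u v : ℝ → ℂ} (hu : Integrable u) (hv : Integrable v) (k : ℝ) :
    fourierTransform (fun x => u x - v x) k = fourierTransform u k - fourierTransform v k := by
  simp_rw [fourierTransform_eq, mul_sub]
  exact integral_sub (integrable_fourierExp_mul hu k) (integrable_fourierExp_mul hv k)

lemma fourierTransform_const_mul (c : ℂ) (u : ℝ → ℂ) (k : ℝ) :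
    fourierTransform (fun x => c * u x) k = c * fourierTransform u k := by
  simp_rw [fourierTransform_eq, mul_left_comm _ c, integral_const_mul]

lemma fourierTransform_smul (c : ℝ) (u : ℝ → ℂ) (k : ℝ) :
    fourierTransform (fun x => c • u x) k = c • fourierTransform u k := by
  simp_rw [Complex.real_smul, fourierTransform_const_mul]

lemma fourierTransform_congr_ae {u v : ℝ → ℂ} (h : ∀ᵐ x, u x = v x) (k : ℝ) :
    fourierTransform u k = fourierTransform v k :=
  integral_congr_ae (h.mono fun x hx => congrArg (fourierExp k x * ·) hx)

lemma norm_fourierTransform_le (u : ℝ → ℂ) (k : ℝ) :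
    ‖fourierTransform u k‖ ≤ ∫ x, ‖u x‖ := by
  rw [fourierTransform_eq]
  refine (norm_integral_le_integral_norm _).trans_eq ?_
  simp_rw [norm_mul, norm_fourierExp, one_mul]

/-- Fourier inversion for continuous integrable functions with integrable transform. -/
theorem eq_integral_fourierTransform {u : ℝ → ℂ} (huc : Continuous u) (hu : Integrable u)
    (hk : Integrable (fourierTransform u)) (x : ℝ) :
    u x = ((1 / (2 * Real.pi) : ℝ) : ℂ) *
      ∫ k : ℝ, fourierTransform u k * Complex.exp (-(Complex.I * k * x)) := by
  -- Mathlib's kernel is e^{-2πikx}, so the two transforms differ by the dilation k ↦ -2πk.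
  have hF : FourierTransform.fourier u = fun k => fourierTransform u (-2 * Real.pi * k) := by
    ext k
    rw [Real.fourier_real_eq_integral_exp_smul, fourierTransform]
    congr 1 with y
    rw [smul_eq_mul]
    congr 2
    push_cast; ring
  have hpi : -2 * Real.pi ≠ 0 := by simp [Real.pi_ne_zero]
  have hinv := congrFun (huc.fourierInv_fourier_eq hu (hF ▸ hk.comp_mul_left' hpi)) x
  rw [← hinv, Real.fourierInv_eq_fourier_neg, Real.fourier_real_eq_integral_exp_smul, hF]
  have hsub := Measure.integral_comp_mul_left
    (fun k : ℝ => fourierTransform u k * Complex.exp (-(Complex.I * k * x))) (-2 * Real.pi)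
  have habs : |(-2 * Real.pi)⁻¹| = 1 / (2 * Real.pi) := by
    rw [abs_inv, neg_mul, abs_neg, abs_of_pos Real.two_pi_pos, one_div]
  rw [habs, Complex.real_smul] at hsub
  rw [← hsub]
  congr 1 with k
  rw [smul_eq_mul, mul_comm]
  congr 2
  push_cast; ring

end FourierTransform

/-! ### Fubini on strips -/

section Strips

variable {F : ℝ → ℝ → ℂ}

lemma IntegrableOnStrips.integrable_prod (hF : IntegrableOnStrips F) {T : ℝ} (hT : 0 < T) :
    Integrable (fun p : ℝ × ℝ => F p.1 p.2)
      ((volume : Measure ℝ).prod (volume.restrict (Ioo 0 T))) := by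
  have h := hF T hT
  rwa [IntegrableOn, Measure.volume_eq_prod, ← Measure.prod_restrict, Measure.restrict_univ] at h

lemma IntegrableOnStrips.ae_intervalIntegrable (hF : IntegrableOnStrips F) :
    ∀ᵐ x, ∀ T, 0 < T → IntervalIntegrable (F x) volume 0 T := by
  -- Countably many strips suffice, so one null set of x serves all T.
  have h : ∀ᵐ x, ∀ n : ℕ, IntegrableOn (F x) (Ioo 0 (n + 1)) :=
    ae_all_iff.2 fun n => (hF.integrable_prod (by positivity)).prod_right_ae
  filter_upwards [h] with x hx T hT
  obtain ⟨n, hn⟩ := exists_nat_ge T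
  rw [intervalIntegrable_iff_integrableOn_Ioo_of_le hT.le]
  exact (hx n).mono_set (Ioo_subset_Ioo_right (by linarith))

lemma IntegrableOnStrips.ae_integrable_slice (hF : IntegrableOnStrips F) {T : ℝ} (hT : 0 < T) :
    ∀ᵐ t ∂volume.restrict (Ioo 0 T), Integrable fun x => F x t :=
  (hF.integrable_prod hT).prod_left_ae

lemma IntegrableOnStrips.intervalIntegrable_fourierTransform (hF : IntegrableOnStrips F) (k : ℝ)
    {T : ℝ} (hT : 0 < T) :
    IntervalIntegrable (fun t => fourierTransform (fun x => F x t) k) volume 0 T := by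
  rw [intervalIntegrable_iff_integrableOn_Ioo_of_le hT.le]
  have h : Integrable (fun p : ℝ × ℝ => fourierExp k p.1 * F p.1 p.2)
      ((volume : Measure ℝ).prod (volume.restrict (Ioo 0 T))) :=
    (hF.integrable_prod hT).bdd_mul (c := 1)
      ((continuous_fourierExp k).comp continuous_fst).aestronglyMeasurable
      (Eventually.of_forall fun p => (norm_fourierExp k p.1).le)
  exact h.integral_prod_right

/-- For ν ≥ 1 the kernel is a multiplier bounded by `rlKernel ν t` on (0,t). -/
lemma IntegrableOnStrips.integrable_rlKernel_smul (hF : IntegrableOnStrips F) {ν : ℝ}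
    (hν : 1 ≤ ν) {t : ℝ} (ht : 0 < t) :
    Integrable (fun p : ℝ × ℝ => rlKernel ν (t - p.2) • F p.1 p.2)
      ((volume : Measure ℝ).prod (volume.restrict (Ioo 0 t))) := by
  refine (hF.integrable_prod ht).bdd_smul (rlKernel ν t)
    ((measurable_rlKernel ν).comp (measurable_const.sub measurable_snd)).aestronglyMeasurable ?_
  have h : ∀ᵐ s ∂volume.restrict (Ioo 0 t), s ∈ Ioo 0 t := ae_restrict_mem measurableSet_Ioo
  filter_upwards [Measure.quasiMeasurePreserving_snd.ae h] with p hp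
  change ‖rlKernel ν (t - p.2)‖ ≤ _
  rw [Real.norm_of_nonneg (rlKernel_nonneg (by linarith) (sub_pos.2 hp.2).le)]
  exact rlKernel_mono hν (sub_pos.2 hp.2).le (by linarith [hp.1])

lemma rlIntegral_eq_setIntegral (ν : ℝ) (u : ℝ → ℂ) {t : ℝ} (ht : 0 < t) :
    rlIntegral ν u t = ∫ s in Ioo 0 t, rlKernel ν (t - s) • u s := by
  rw [rlIntegral_eq, intervalIntegral.integral_of_le ht.le, integral_Ioc_eq_integral_Ioo]

lemma IntegrableOnStrips.integrable_rlIntegral (hF : IntegrableOnStrips F) {ν : ℝ}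
    (hν : 1 ≤ ν) {t : ℝ} (ht : 0 < t) : Integrable fun x => rlIntegral ν (F x) t := by
  simp_rw [rlIntegral_eq_setIntegral ν _ ht]
  exact (hF.integrable_rlKernel_smul hν ht).integral_prod_left

/-- The Fourier transform in space commutes with fractional integration in time. -/
lemma IntegrableOnStrips.fourierTransform_rlIntegral (hF : IntegrableOnStrips F) {ν : ℝ}
    (hν : 1 ≤ ν) {t : ℝ} (ht : 0 < t) (k : ℝ) :
    fourierTransform (fun x => rlIntegral ν (F x) t) k =
      rlIntegral ν (fun s => fourierTransform (fun x => F x s) k) t := by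
  have h : Integrable
      (fun p : ℝ × ℝ => fourierExp k p.1 * (rlKernel ν (t - p.2) • F p.1 p.2))
      ((volume : Measure ℝ).prod (volume.restrict (Ioo 0 t))) :=
    (hF.integrable_rlKernel_smul hν ht).bdd_mul (c := 1)
      ((continuous_fourierExp k).comp continuous_fst).aestronglyMeasurable
      (Eventually.of_forall fun p => (norm_fourierExp k p.1).le)
  have hswap := integral_integral_swap
    (f := fun x s => fourierExp k x * (rlKernel ν (t - s) • F x s)) h
  simp_rw [rlIntegral_eq_setIntegral ν _ ht, fourierTransform_eq, ← integral_const_mul]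
  rw [hswap]
  simp_rw [← integral_smul, mul_smul_comm]

end Strips

/-! ### Fourier transform of the solution -/

section Solution

variable {β α η : ℝ} {φ N : ℝ → ℝ → ℂ} {f g : ℝ → ℂ}

lemma IsSolution.continuousOn_fourierTransform (hN : IsSolution β α η φ f g N) (k : ℝ) :
    ContinuousOn (fun t => fourierTransform (fun x => N x t) k) (Ioi 0) := by
  intro t ht
  refine ContinuousAt.continuousWithinAt (tendsto_iff_norm_sub_tendsto_zero.2 ?_)
  refine squeeze_zero' (Eventually.of_forall fun s => norm_nonneg _) ?_ (hN.tendsto_slice t ht)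
  filter_upwards [Ioi_mem_nhds ht] with s hs
  rw [← fourierTransform_sub (hN.integrable_slice s hs) (hN.integrable_slice t ht)]
  exact norm_fourierTransform_le _ k

/-- Only almost every t is reached, since φ(·,t) need be integrable only for those t; this is enough
under a fractional integral. -/
lemma IsSolution.fourierTransform_rlDeriv (hN : IsSolution β α η φ f g N)
    (hφ : IntegrableOnStrips φ) (k : ℝ) {T : ℝ} (hT : 0 < T) :
    ∀ᵐ t ∂volume.restrict (Ioo 0 T), fourierTransform (fun x => rlDeriv β (N x) t) k =
      -((η * |k| ^ α : ℝ) : ℂ) * fourierTransform (fun x => N x t) k +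
        fourierTransform (fun x => φ x t) k := by
  obtain ⟨W, hW, heq⟩ := hN.equation
  filter_upwards [hφ.ae_integrable_slice hT, ae_restrict_mem measurableSet_Ioo] with t hφt ht
  rw [fourierTransform_congr_ae (heq t ht.1),
    fourierTransform_add ((hW t ht.1).integrable_right.const_mul _) hφt,
    fourierTransform_const_mul, (hW t ht.1).fourier_eq]
  push_cast
  ring

lemma IsSolution.rlIntegral_two_fourierTransform (hβ₁ : 1 < β) (hβ₂ : β ≤ 2)
    (hf : Integrable f) (hg : Integrable g) (hφ : IntegrableOnStrips φ)
    (hN : IsSolution β α η φ f g N) (k : ℝ) {t : ℝ} (ht : 0 < t) :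
    rlIntegral 2 (fun s => fourierTransform (fun x => N x s) k) t =
      rlKernel (β + 1) t • fourierTransform g k + rlKernel (β + 2) t • fourierTransform f k +
      rlIntegral (β + 2) (fun s => -((η * |k| ^ α : ℝ) : ℂ) * fourierTransform (fun x => N x s) k +
        fourierTransform (fun x => φ x s) k) t := by
  have hae : ∀ᵐ x, rlIntegral 2 (N x) t = rlKernel (β + 1) t • g x + rlKernel (β + 2) t • f x +
      rlIntegral (β + 2) (rlDeriv β (N x)) t := by
    filter_upwards [hN.integrable.ae_intervalIntegrable,
      hN.integrable_rlDeriv.ae_intervalIntegrable, hN.rlDifferentiable, hN.initial_f,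
      hN.initial_g] with x h1 h2 h3 h4 h5
    exact rlIntegral_two_eq_of_initial hβ₁ hβ₂ h1 h2 h3 h4 h5 ht
  have ig : Integrable fun x => rlKernel (β + 1) t • g x := hg.smul (rlKernel (β + 1) t)
  have jf : Integrable fun x => rlKernel (β + 2) t • f x := hf.smul (rlKernel (β + 2) t)
  have hβ : 1 ≤ β + 2 := by linarith
  have igf : Integrable fun x => rlKernel (β + 1) t • g x + rlKernel (β + 2) t • f x := ig.add jf
  have iD : Integrable fun x => rlIntegral (β + 2) (rlDeriv β (N x)) t :=
    hN.integrable_rlDeriv.integrable_rlIntegral hβ ht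
  have hD : fourierTransform (fun x => rlIntegral (β + 2) (rlDeriv β (N x)) t) k = _ :=
    hN.integrable_rlDeriv.fourierTransform_rlIntegral hβ ht k
  rw [← hN.integrable.fourierTransform_rlIntegral one_le_two ht, fourierTransform_congr_ae hae,
    fourierTransform_add igf iD, fourierTransform_add ig jf, fourierTransform_smul,
    fourierTransform_smul, hD,
    rlIntegral_congr_ae ht (hN.fourierTransform_rlDeriv hφ k ht)]

/-- The Fourier transform of a solution. -/
theorem IsSolution.fourierTransform_eq (hβ₁ : 1 < β) (hβ₂ : β ≤ 2)
    (hf : Integrable f) (hg : Integrable g) (hφ : IntegrableOnStrips φ)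
    (hN : IsSolution β α η φ f g N) {t : ℝ} (ht : 0 < t) (k : ℝ) :
    fourierTransform (fun x => N x t) k =
        fourierTransform f k * (t ^ (β - 1) * mittagLeffler β β (-η * |k| ^ α * t ^ β) : ℝ)
        + fourierTransform g k *
            (t ^ (β - 2) * mittagLeffler β (β - 1) (-η * |k| ^ α * t ^ β) : ℝ)
        + ∫ ξ in (0 : ℝ)..t, fourierTransform (fun x => φ x (t - ξ)) k *
            (ξ ^ (β - 1) * mittagLeffler β β (-η * |k| ^ α * ξ ^ β) : ℝ) := by
  have hn := fun T hT => hN.integrable.intervalIntegrable_fourierTransform k (T := T) hT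
  have hp := fun T hT => hφ.intervalIntegrable_fourierTransform k (T := T) hT
  -- For fixed k, Ñ(k,·) solves the Volterra equation with l = η|k|^α.
  have hvol := fun (t : ℝ) (ht : 0 < t) =>
    volterra_of_rlIntegral_two hβ₁ hn (hN.continuousOn_fourierTransform k)
      (fun T hT => ((hn T hT).const_mul _).add (hp T hT))
      (fun t ht => hN.rlIntegral_two_fourierTransform hβ₁ hβ₂ hf hg hφ k ht) ht
  have hsol := volterra_solution hβ₁ hn hp hvol ht
  simp only [neg_mul] at hsol ⊢
  exact hsol

end Solution

end FracReactionDiffusion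

end

/-! ### The main theorem -/

open FracReactionDiffusion in
theorem mainTheorem1 (β α η : ℝ) (hβ₁ : 1 < β) (hβ₂ : β ≤ 2) (hα : 0 ≤ α) (hη : 0 < η)
    (φ : ℝ → ℝ → ℂ) (f g : ℝ → ℂ) (N : ℝ → ℝ → ℂ)
    (hf : Integrable f) (hg : Integrable g) (hφ : IntegrableOnStrips φ)
    (hN : IsSolution β α η φ f g N) (t : ℝ) (ht : 0 < t) :
    (∀ k : ℝ, fourierTransform (fun x => N x t) k =
        fourierTransform f k * (t ^ (β - 1) * mittagLeffler β β (-η * |k| ^ α * t ^ β) : ℝ)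
        + fourierTransform g k *
            (t ^ (β - 2) * mittagLeffler β (β - 1) (-η * |k| ^ α * t ^ β) : ℝ)
        + ∫ ξ in (0 : ℝ)..t, fourierTransform (fun x => φ x (t - ξ)) k *
            (ξ ^ (β - 1) * mittagLeffler β β (-η * |k| ^ α * ξ ^ β) : ℝ)) ∧
    (Integrable (fun k : ℝ =>
        fourierTransform f k * (mittagLeffler β β (-η * |k| ^ α * t ^ β) : ℂ)) →
      Integrable (fun k : ℝ =>
        fourierTransform g k * (mittagLeffler β (β - 1) (-η * |k| ^ α * t ^ β) : ℂ)) →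
      Integrable (fun p : ℝ × ℝ => ((p.1 ^ (β - 1) : ℝ) : ℂ) *
          (fourierTransform (fun x => φ x (t - p.1)) p.2 *
            (mittagLeffler β β (-η * |p.2| ^ α * p.1 ^ β) : ℂ)))
        ((volume.restrict (Ioo 0 t)).prod volume) →
      ∀ x : ℝ, N x t =
        ((t ^ (β - 1) / (2 * Real.pi) : ℝ) : ℂ) * (∫ k : ℝ, fourierTransform f k *
            (mittagLeffler β β (-η * |k| ^ α * t ^ β) : ℂ) *
            Complex.exp (-(Complex.I * k * x)))
        + ((t ^ (β - 2) / (2 * Real.pi) : ℝ) : ℂ) * (∫ k : ℝ, fourierTransform g k *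
            (mittagLeffler β (β - 1) (-η * |k| ^ α * t ^ β) : ℂ) *
            Complex.exp (-(Complex.I * k * x)))
        + ((1 / (2 * Real.pi) : ℝ) : ℂ) * ∫ ξ in (0 : ℝ)..t, ((ξ ^ (β - 1) : ℝ) : ℂ) *
            ∫ k : ℝ, fourierTransform (fun y => φ y (t - ξ)) k *
              (mittagLeffler β β (-η * |k| ^ α * ξ ^ β) : ℂ) *
              Complex.exp (-(Complex.I * k * x))) := by
  refine ⟨hN.fourierTransform_eq hβ₁ hβ₂ hf hg hφ ht, fun i1 i2 i3 x => ?_⟩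
  set e : ℝ → ℂ := fun k => Complex.exp (-(Complex.I * k * x)) with he
  have hec : Continuous e := by fun_prop
  have hen : ∀ k, ‖e k‖ ≤ 1 := fun k => by
    have : e k = fourierExp (-k) x := by simp [he, fourierExp]
    rw [this, norm_fourierExp]
  have hmul : ∀ {u : ℝ → ℂ}, Integrable u → Integrable fun k => u k * e k := fun hu =>
    hu.mul_bdd (c := 1) hec.aestronglyMeasurable (Eventually.of_forall hen)
  set H : ℝ × ℝ → ℂ := fun p => ((p.1 ^ (β - 1) : ℝ) : ℂ) *
    (fourierTransform (fun x => φ x (t - p.1)) p.2 *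
      (mittagLeffler β β (-η * |p.2| ^ α * p.1 ^ β) : ℂ)) with hH
  have hft : fourierTransform (fun x => N x t) = fun k =>
      ((t ^ (β - 1) : ℝ) : ℂ) *
        (fourierTransform f k * (mittagLeffler β β (-η * |k| ^ α * t ^ β) : ℂ)) +
      ((t ^ (β - 2) : ℝ) : ℂ) *
        (fourierTransform g k * (mittagLeffler β (β - 1) (-η * |k| ^ α * t ^ β) : ℂ)) +
      ∫ ξ in Ioo 0 t, H (ξ, k) := by
    ext k
    rw [hN.fourierTransform_eq hβ₁ hβ₂ hf hg hφ ht k, intervalIntegral.integral_of_le ht.le,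
      integral_Ioc_eq_integral_Ioo]
    congr 1
    · push_cast; ring
    · congr 1 with ξ
      rw [hH]
      push_cast; ring
  have j1 := i1.const_mul ((t ^ (β - 1) : ℝ) : ℂ)
  have j2 := i2.const_mul ((t ^ (β - 2) : ℝ) : ℂ)
  -- Joint integrability in (ξ,k) makes the source term of Ñ(·,t) integrable in k; with `j1` and
  -- `j2` this permits inversion.
  have j3 := i3.integral_prod_right
  rw [eq_integral_fourierTransform (hN.continuous_slice t ht) (hN.integrable_slice t ht)
    (hft ▸ (j1.add j2).add j3) x, hft]
  have hsplit := integral_add ((hmul j1).add (hmul j2)) (hmul j3)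
  have hsplit' := integral_add (hmul j1) (hmul j2)
  simp only [Pi.add_apply] at hsplit hsplit'
  have hswap : ∫ k, (∫ ξ in Ioo 0 t, H (ξ, k)) * e k =
      ∫ ξ in (0 : ℝ)..t, ((ξ ^ (β - 1) : ℝ) : ℂ) *
        ∫ k : ℝ, fourierTransform (fun y => φ y (t - ξ)) k *
          (mittagLeffler β β (-η * |k| ^ α * ξ ^ β) : ℂ) * e k := by
    have i4 : Integrable (fun p : ℝ × ℝ => H p * e p.2)
        ((volume.restrict (Ioo 0 t)).prod volume) :=
      i3.mul_bdd (c := 1) (hec.comp continuous_snd).aestronglyMeasurable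
        (Eventually.of_forall fun p => hen p.2)
    have h := integral_integral_swap (f := fun ξ k => H (ξ, k) * e k) i4
    rw [intervalIntegral.integral_of_le ht.le, integral_Ioc_eq_integral_Ioo]
    simp_rw [← integral_mul_const, ← integral_const_mul]
    rw [← h]
    simp only [hH, mul_assoc]
  have hexp : ∀ k : ℝ, Complex.exp (-(Complex.I * k * x)) = e k := fun _ => rfl
  simp_rw [hexp, add_mul]
  rw [hsplit, hsplit', hswap]
  simp_rw [mul_assoc, integral_const_mul]
  push_cast
  ring
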